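/- Let $D$ be a division ring which is finite-dimensional over its center. A valuation on $D$ is a surjective homomorphism $v\colon D^\times\to\Gamma_v$ onto a totally ordered group $\Gamma_v$ (written additively, not assumed commutative) such that $v(a+b)\ge\min\{v(a),v(b)\}$ whenever $a,b\in D^\times$ and $a+b\ne 0$; it is nontrivial if $\Gamma_v\neq\{0\}$. Two valuations $v,v'$ are regarded as equal if $v'=\sigma\circ v$ for some isomorphism $\sigma\colon\Gamma_v\to\Gamma_{v'}$ of totally ordered groups, and as distinct otherwise. The height of $v$ is the supremum of all integers $r\ge 0$ for which there is a chain $\Gamma_v=\Gamma_0\to\Gamma_1\to\cdots\to\Gamma_r=\{0\}$ of epimorphisms of totally ordered groups all having nontrivial kernels. The $v$-adic topology on $D$ is the one in which the sets $\{x\}\cup\{x+y : y\in D^\times,\ v(y)>\delta\}$, $\delta\in\Gamma_v$, $\delta\ge 0$, form a fundamental system of neighborhoods of each $x\in D$; $D^\times$ carries the induced topology, and a subgroup of $D^\times$ is called $v$-adically open if it is open in it. Let $r\ge 2$, let $w_1,\dots,w_r$ be (pairwise) distinct valuations of height $1$ on $D$, and let $N_1,\dots,N_r$ be proper subgroups of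 $D^\times$ such that $N_i$ is $w_i$-adically open for $i=1,\dots,r$. Let $N=N_1\cap\cdots\cap N_r$. Then $N$ is not $u$-adically open for any nontrivial valuation $u$ on $D$. -/

import Mathlib

universe u v

/-- `HasEpiChain r Γ`: there is a chain `Γ = Γ₀ → Γ₁ → ⋯ → Γ_r = {0}` of epimorphisms of totally
ordered groups (surjective monotone homomorphisms), all with nontrivial kernels. -/
def HasEpiChain : ℕ → ∀ (Γ : Type v) [AddGroup Γ] [LinearOrder Γ], Prop
  | 0, Γ, _, _ => Subsingleton Γ
  | r + 1, Γ, _, _ =>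
      ∃ (Γ' : Type v) (_ : AddGroup Γ') (_ : LinearOrder Γ') (_ : AddLeftMono Γ')
        (_ : AddRightMono Γ') (μ : Γ →+ Γ'),
        Function.Surjective μ ∧ Monotone μ ∧ μ.ker ≠ ⊥ ∧ HasEpiChain r Γ'

/-- The height (rank) of a totally ordered group: the supremum of the lengths of chains of
epimorphisms with nontrivial kernels ending in the trivial group. -/
noncomputable def ordHeight (Γ : Type v) [AddGroup Γ] [LinearOrder Γ] : ℕ∞ :=
  ⨆ (r : ℕ) (_ : HasEpiChain r Γ), (r : ℕ∞)

/-- A valuation on a division ring `D`: a surjective homomorphism from `Dˣ` onto a (not necessarily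
commutative) totally ordered group `Γ`, written additively, such that
`v (a + b) ≥ min (v a) (v b)` whenever `a + b ≠ 0`. -/
structure DivValuation (D : Type u) [DivisionRing D] (Γ : Type v) [AddGroup Γ] [LinearOrder Γ]
    [AddLeftMono Γ] [AddRightMono Γ] where
  toFun : Dˣ → Γ
  map_mul : ∀ a b : Dˣ, toFun (a * b) = toFun a + toFun b
  surjective : Function.Surjective toFun
  min_le_map_add : ∀ a b c : Dˣ, (c : D) = (a : D) + (b : D) →
    min (toFun a) (toFun b) ≤ toFun c

namespace DivValuation

variable {D : Type u} [DivisionRing D] {Γ : Type v} [AddGroup Γ] [LinearOrder Γ]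
  [AddLeftMono Γ] [AddRightMono Γ]

/-- The valuation is not the trivial one. -/
def IsNontrivial (w : DivValuation D Γ) : Prop := ∃ x : Dˣ, w.toFun x ≠ 0

/-- The height of a valuation is the height of its value group. -/
noncomputable def height (_w : DivValuation D Γ) : ℕ∞ := ordHeight Γ

/-- Two valuations are identified when they differ by an isomorphism of totally ordered
value groups. -/
def IsEquiv {Γ' : Type*} [AddGroup Γ'] [LinearOrder Γ'] [AddLeftMono Γ'] [AddRightMono Γ']
    (w : DivValuation D Γ) (w' : DivValuation D Γ') : Prop :=
  ∃ e : Γ ≃+o Γ', ∀ x : Dˣ, w'.toFun x = e (w.toFun x)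

/-- `𝔪(δ) = {x ∈ Dˣ : w x > δ} ∪ {0}`. -/
def idealGT (w : DivValuation D Γ) (δ : Γ) : Set D :=
  {x | x = 0 ∨ ∃ a : Dˣ, (a : D) = x ∧ δ < w.toFun a}

theorem idealGT_anti (w : DivValuation D Γ) {δ ε : Γ} (h : δ ≤ ε) :
    w.idealGT ε ⊆ w.idealGT δ := by
  rintro x (hx | ⟨a, ha, hlt⟩)
  · exact Or.inl hx
  · exact Or.inr ⟨a, ha, lt_of_le_of_lt h hlt⟩

/-- The `w`-adic topology on `D`: the sets `x + 𝔪(δ)`, `δ ≥ 0`, form a fundamental system of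
neighbourhoods of `x`. -/
@[reducible] def adicTopology (w : DivValuation D Γ) : TopologicalSpace D where
  IsOpen U := ∀ x ∈ U, ∃ δ : Γ, 0 ≤ δ ∧ ∀ y ∈ w.idealGT δ, x + y ∈ U
  isOpen_univ := fun _ _ => ⟨0, le_refl 0, fun _ _ => trivial⟩
  isOpen_inter := by
    intro U V hU hV x hx
    obtain ⟨δ, hδ, h1⟩ := hU x hx.1
    obtain ⟨ε, _, h2⟩ := hV x hx.2
    exact ⟨max δ ε, le_trans hδ (le_max_left _ _), fun y hy =>
      ⟨h1 y (w.idealGT_anti (le_max_left _ _) hy), h2 y (w.idealGT_anti (le_max_right _ _) hy)⟩⟩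
  isOpen_sUnion := by
    intro S hS x hx
    obtain ⟨U, hU, hxU⟩ := hx
    obtain ⟨δ, hδ, h⟩ := hS U hU x hxU
    exact ⟨δ, hδ, fun y hy => ⟨U, hU, h y hy⟩⟩

/-- The `w`-adic topology on `Dˣ`, induced from the `w`-adic topology on `D`. -/
@[reducible] def unitsAdicTopology (w : DivValuation D Γ) : TopologicalSpace Dˣ :=
  TopologicalSpace.induced (fun a : Dˣ => (a : D)) w.adicTopology

/-- A subgroup of `Dˣ` is `w`-adically open if it is open in the `w`-adic topology of `Dˣ`. -/
def IsAdicOpen (w : DivValuation D Γ) (N : Subgroup Dˣ) : Prop :=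
  w.unitsAdicTopology.IsOpen (N : Set Dˣ)

end DivValuation

/-! Suppose `N` is `u`-open. Each `N i` then contains both a `u`-neighbourhood and a `w
i`-neighbourhood of `1`. If some units could be arbitrarily `u`-large while arbitrarily `w i`-small,
every unit would be a product of elements of these neighbourhoods, making `N i` everything
(`eq_top_of_weak_approximation`). So approximation fails, and since `w i` is archimedean this puts
the valuation ring of `u` inside that of `w i`. Two archimedean coarsenings of the same `u` have the
same valuation ring, hence are equivalent, against distinctness.

Height one gives the archimedean property only once convex subgroups are known to be normal; finite
dimension over the center supplies this (`exists_nsmul_central`). -/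

section QuotientOrder

/-! ### Height one and the archimedean property -/

variable {Γ : Type v} [AddGroup Γ] [LinearOrder Γ] [AddLeftMono Γ]

theorem exists_pos_of_ordHeight_eq_one (h : ordHeight Γ = 1) : ∃ g : Γ, 0 < g := by
  by_contra! hg
  have h0 : ∀ g : Γ, g = 0 := fun g => le_antisymm (hg g) (by simpa using hg (-g))
  have : ordHeight Γ ≤ 0 := by
    refine iSup₂_le fun r hr => ?_
    cases r with
    | zero => simp
    | succ r =>
      obtain ⟨_, _, _, _, _, μ, _, _, hk, _⟩ := hr
      exact absurd ((AddSubgroup.eq_bot_iff_forall _).2 fun x _ => h0 x) hk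
  simp [h] at this

variable [AddRightMono Γ]

/-- The linear order on the quotient of a totally ordered group by a convex normal subgroup. -/
@[reducible] noncomputable def quotientLinearOrder (H : AddSubgroup Γ) [H.Normal]
    (hH : ∀ a b : Γ, 0 ≤ a → a ≤ b → b ∈ H → a ∈ H) : LinearOrder (Γ ⧸ H) where
  le p q := ∃ a b : Γ, (a : Γ ⧸ H) = p ∧ (b : Γ ⧸ H) = q ∧ a ≤ b
  le_refl p := by
    induction p using QuotientAddGroup.induction_on with
    | H a => exact ⟨a, a, rfl, rfl, le_rfl⟩
  le_trans := by
    rintro _ _ _ ⟨a, b, rfl, rfl, hab⟩ ⟨b', c, hb, rfl, hbc⟩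
    -- `-b' + b` lies in `H`, so this is another representative of the class of `c`, now comparable
    -- with `b`.
    refine ⟨a, c + (-b' + b), rfl, ?_, hab.trans ?_⟩
    · simp [hb]
    · simpa using add_le_add_left hbc (-b' + b)
  le_antisymm := by
    rintro _ _ ⟨a, b, rfl, rfl, hab⟩ ⟨b', a', hb, ha, hba⟩
    rw [QuotientAddGroup.eq]
    have h1 : b ≤ a' + (-b' + b) := by simpa using add_le_add_left hba (-b' + b)
    refine hH _ (-a + (a' + (-b' + b))) ?_ (add_le_add_right h1 _) ?_
    · simpa using add_le_add_right hab (-a)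
    · rw [← QuotientAddGroup.eq]
      simp [hb, ha]
  le_total p q := by
    induction p using QuotientAddGroup.induction_on with
    | H a =>
      induction q using QuotientAddGroup.induction_on with
      | H b =>
        rcases le_total a b with h | h
        · exact Or.inl ⟨a, b, rfl, rfl, h⟩
        · exact Or.inr ⟨b, a, rfl, rfl, h⟩
  toDecidableLE := Classical.decRel _

/-- The chain is `Γ → Γ ⧸ H → 0`. -/
theorem two_le_ordHeight (H : AddSubgroup Γ) [H.Normal]
    (hH : ∀ a b : Γ, 0 ≤ a → a ≤ b → b ∈ H → a ∈ H) (hbot : H ≠ ⊥) (htop : H ≠ ⊤) :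
    2 ≤ ordHeight Γ := by
  let _ := quotientLinearOrder H hH
  have hl : AddLeftMono (Γ ⧸ H) := by
    refine ⟨?_⟩
    rintro p _ _ ⟨a, b, rfl, rfl, h⟩
    induction p using QuotientAddGroup.induction_on with
    | H c => exact ⟨c + a, c + b, rfl, rfl, add_le_add_right h c⟩
  have hr : AddRightMono (Γ ⧸ H) := by
    refine ⟨?_⟩
    rintro p _ _ ⟨a, b, rfl, rfl, h⟩
    induction p using QuotientAddGroup.induction_on with
    | H c => exact ⟨a + c, b + c, rfl, rfl, add_le_add_left h c⟩
  have hchain : HasEpiChain 2 Γ := by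
    refine ⟨Γ ⧸ H, inferInstance, inferInstance, hl, hr, QuotientAddGroup.mk' H,
      QuotientAddGroup.mk'_surjective H, fun a b h => ⟨a, b, rfl, rfl, h⟩, by simpa using hbot,
      PUnit, inferInstance, inferInstance, inferInstance, inferInstance, 0,
      fun _ => ⟨0, rfl⟩, fun _ _ _ => le_rfl, ?_, inferInstanceAs (Subsingleton PUnit)⟩
    intro h
    apply htop
    rw [eq_top_iff]
    intro x _
    have hx : (x : Γ ⧸ H) ∈ (0 : Γ ⧸ H →+ PUnit).ker := rfl
    rw [h, AddSubgroup.mem_bot, QuotientAddGroup.eq_zero_iff] at hx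
    exact hx
  exact le_iSup₂_of_le (f := fun (r : ℕ) (_ : HasEpiChain r Γ) => (r : ℕ∞)) 2 hchain le_rfl

/-- A totally ordered group of height one is archimedean if every element has a nonzero central
multiple: convex subgroups generated by one element are then normal. -/
theorem exists_le_nsmul_of_ordHeight_eq_one
    (hcen : ∀ g : Γ, ∃ n : ℕ, n ≠ 0 ∧ ∀ h : Γ, AddCommute (n • g) h)
    (hone : ordHeight Γ = 1) {g : Γ} (hg : 0 < g) (h : Γ) : ∃ n : ℕ, h ≤ n • g := by
  obtain ⟨m, hm, hmg⟩ := hcen g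
  set k := m • g with hk
  have hgk : g ≤ k := by
    simpa using nsmul_le_nsmul_left hg.le (Nat.one_le_iff_ne_zero.2 hm)
  have hk0 : 0 < k := hg.trans_le hgk
  have hneg : ∀ n : ℕ, ∀ x : Γ, AddCommute (n • k) x := fun n x => (hmg x).nsmul_left n
  let H : AddSubgroup Γ :=
    { carrier := {x | ∃ n : ℕ, x ≤ n • k ∧ -x ≤ n • k}
      zero_mem' := ⟨0, by simp⟩
      add_mem' := by
        rintro x y ⟨a, ha, ha'⟩ ⟨b, hb, hb'⟩
        refine ⟨a + b, ?_, ?_⟩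
        · rw [add_nsmul]; exact add_le_add ha hb
        · rw [neg_add_rev, add_comm a, add_nsmul]; exact add_le_add hb' ha'
      neg_mem' := by
        rintro x ⟨a, ha, ha'⟩
        exact ⟨a, ha', by simpa using ha⟩ }
  have hN : H.Normal := by
    refine ⟨?_⟩
    rintro x ⟨a, ha, ha'⟩ y
    refine ⟨a, ?_, ?_⟩
    · calc y + x + -y ≤ y + a • k + -y := by gcongr
        _ = a • k := by rw [← (hneg a y).eq]; simp
    · calc -(y + x + -y) = y + -x + -y := by simp [add_assoc]
        _ ≤ y + a • k + -y := by gcongr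
        _ = a • k := by rw [← (hneg a y).eq]; simp
  have hconv : ∀ a b : Γ, 0 ≤ a → a ≤ b → b ∈ H → a ∈ H := by
    rintro a b h0 hab ⟨n, hn, -⟩
    exact ⟨n, hab.trans hn, (neg_nonpos.2 h0).trans (nsmul_nonneg hk0.le n)⟩
  have hkH : k ∈ H := ⟨1, by simp, by simpa using (neg_nonpos.2 hk0.le).trans hk0.le⟩
  have hbot : H ≠ ⊥ := by
    intro e
    rw [e, AddSubgroup.mem_bot] at hkH
    exact hk0.ne' hkH
  have htop : H = ⊤ := by
    by_contra htop
    have := two_le_ordHeight H hconv hbot htop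
    rw [hone] at this
    exact absurd this (by decide)
  obtain ⟨n, hn, -⟩ : h ∈ H := htop ▸ AddSubgroup.mem_top h
  exact ⟨n * m, by rwa [mul_nsmul', ← hk]⟩

end QuotientOrder

namespace DivValuation

/-! ### Values of sums, central multiples of values, open subgroups -/

section Basic

variable {D : Type u} [DivisionRing D] {Γ : Type v} [AddGroup Γ] [LinearOrder Γ]
  [AddLeftMono Γ] [AddRightMono Γ] (w : DivValuation D Γ)

theorem map_one : w.toFun 1 = 0 := by
  simpa using w.map_mul 1 1

theorem map_inv (a : Dˣ) : w.toFun a⁻¹ = -w.toFun a := by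
  rw [eq_neg_iff_add_eq_zero, ← w.map_mul, inv_mul_cancel, w.map_one]

theorem map_pow (a : Dˣ) (n : ℕ) : w.toFun (a ^ n) = n • w.toFun a := by
  induction n with
  | zero => simp [w.map_one]
  | succ n ih => rw [pow_succ, w.map_mul, ih, succ_nsmul]

theorem map_neg_one : w.toFun (-1) = 0 := by
  have h : w.toFun (-1) + w.toFun (-1) = 0 := by
    rw [← w.map_mul]; simp [w.map_one]
  rcases lt_trichotomy (w.toFun (-1)) 0 with h1 | h1 | h1
  · exact absurd h (add_neg h1 h1).ne
  · exact h1
  · exact absurd h (add_pos h1 h1).ne'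

theorem map_neg (a : Dˣ) : w.toFun (-a) = w.toFun a := by
  rw [← neg_one_mul, w.map_mul, w.map_neg_one, zero_add]

theorem map_add_eq_of_lt {a b c : Dˣ} (h : (c : D) = a + b) (hlt : w.toFun a < w.toFun b) :
    w.toFun c = w.toFun a := by
  apply le_antisymm
  · have := w.min_le_map_add c (-b) a (by simp [h])
    rw [w.map_neg] at this
    rcases min_le_iff.1 this with h1 | h1
    · exact h1
    · exact absurd h1 (not_le.2 hlt)
  · simpa [hlt.le] using w.min_le_map_add a b c h

theorem add_mem_idealGT {δ : Γ} {x y : D} (hx : x ∈ w.idealGT δ) (hy : y ∈ w.idealGT δ) :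
    x + y ∈ w.idealGT δ := by
  rcases hx with rfl | ⟨a, rfl, ha⟩
  · simpa using hy
  rcases hy with rfl | ⟨b, rfl, hb⟩
  · rw [add_zero]; exact Or.inr ⟨a, rfl, ha⟩
  by_cases h : (a : D) + b = 0
  · exact Or.inl h
  · exact Or.inr ⟨Units.mk0 _ h, rfl, (lt_min ha hb).trans_le (w.min_le_map_add a b _ rfl)⟩

theorem sum_mem_idealGT {ι : Type*} {δ : Γ} (s : Finset ι) (f : ι → D)
    (hf : ∀ i ∈ s, f i ∈ w.idealGT δ) : ∑ i ∈ s, f i ∈ w.idealGT δ :=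
  Finset.sum_induction f (· ∈ w.idealGT δ) (fun _ _ => w.add_mem_idealGT) (Or.inl rfl) hf

theorem coe_notMem_idealGT {a : Dˣ} {δ : Γ} (h : w.toFun a ≤ δ) : (a : D) ∉ w.idealGT δ := by
  rintro (h0 | ⟨b, hb, hlt⟩)
  · exact a.ne_zero h0
  · rw [Units.ext hb] at hlt
    exact absurd hlt (not_lt.2 h)

/-- If finitely many units have sum zero, then two of them have the same value. -/
theorem exists_eq_of_sum_eq_zero {ι : Type*} [DecidableEq ι] {s : Finset ι} (hs : s.Nonempty)
    (f : ι → Dˣ) (hf : ∑ i ∈ s, (f i : D) = 0) :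
    ∃ i ∈ s, ∃ j ∈ s, i ≠ j ∧ w.toFun (f i) = w.toFun (f j) := by
  by_contra! hne
  obtain ⟨i, hi, hmin⟩ := s.exists_min_image (fun i => w.toFun (f i)) hs
  have hmem : ∑ j ∈ s.erase i, ((-f j : Dˣ) : D) ∈ w.idealGT (w.toFun (f i)) := by
    refine w.sum_mem_idealGT _ _ fun j hj => Or.inr ⟨-f j, rfl, ?_⟩
    rw [w.map_neg]
    have hj' := Finset.mem_erase.1 hj
    exact lt_of_le_of_ne (hmin j hj'.2) (hne i hi j hj'.2 hj'.1.symm)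
  refine w.coe_notMem_idealGT le_rfl (?_ : ((f i : Dˣ) : D) ∈ _)
  · rw [← Finset.add_sum_erase s _ hi] at hf
    convert hmem using 1
    simpa using eq_neg_of_add_eq_zero_left hf

/-- A lift `x` of `g` is a root of a nonzero polynomial over the center. Two of its terms `c i * x ^
i`, `c j * x ^ j` share a value, so `(j - i) • g` is a difference of values of central units. -/
theorem exists_nsmul_central (w : DivValuation D Γ) [FiniteDimensional (Subring.center D) D] (g : Γ) :
    ∃ n : ℕ, n ≠ 0 ∧ ∀ h : Γ, AddCommute (n • g) h := by
  classical
  obtain ⟨x, rfl⟩ := w.surjective g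
  obtain ⟨p, hp0, hp⟩ := Algebra.IsAlgebraic.isAlgebraic (R := Subring.center D) (x : D)
  have hc : ∀ i, p.coeff i ≠ 0 → ((p.coeff i : Subring.center D) : D) ≠ 0 := fun i hi h =>
    hi (Subtype.ext h)
  let c : ℕ → Dˣ := fun i => if h : ((p.coeff i : Subring.center D) : D) = 0 then 1 else
    Units.mk0 _ h
  have hcc : ∀ i ∈ p.support, (c i : D) = (p.coeff i : Subring.center D) := fun i hi => by
    simp only [c, dif_neg (hc i (Polynomial.mem_support_iff.1 hi)), Units.val_mk0]
  have hcomm : ∀ i ∈ p.support, ∀ y : Dˣ, c i * y = y * c i := fun i hi y => by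
    ext
    rw [Units.val_mul, Units.val_mul, hcc i hi]
    exact (Subring.mem_center_iff.1 (p.coeff i).2 y).symm
  have hadd : ∀ i ∈ p.support, ∀ h : Γ, AddCommute (w.toFun (c i)) h := fun i hi h => by
    obtain ⟨y, rfl⟩ := w.surjective h
    rw [AddCommute, AddSemiconjBy, ← w.map_mul, ← w.map_mul, hcomm i hi]
  have hsum : ∑ i ∈ p.support, ((c i * x ^ i : Dˣ) : D) = 0 := by
    rw [Polynomial.aeval_eq_sum_range, ← Polynomial.sum_over_range p
      (f := fun i a => a • (x : D) ^ i) (by simp), Polynomial.sum] at hp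
    rw [← hp]
    refine Finset.sum_congr rfl fun i hi => ?_
    rw [Units.val_mul, hcc i hi, Units.val_pow_eq_pow_val]
    rfl
  obtain ⟨i, hi, j, hj, hij, he⟩ := w.exists_eq_of_sum_eq_zero
    (Polynomial.support_nonempty.2 hp0) (fun i => c i * x ^ i) hsum
  have key : ∀ i ∈ p.support, ∀ j ∈ p.support, i < j →
      w.toFun (c i * x ^ i) = w.toFun (c j * x ^ j) →
      ∃ n : ℕ, n ≠ 0 ∧ ∀ h : Γ, AddCommute (n • w.toFun x) h := by
    intro i hi j hj hij he
    refine ⟨j - i, by omega, fun h => ?_⟩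
    have hji : (j - i) • w.toFun x = -w.toFun (c j) + w.toFun (c i) := by
      have hjx : j • w.toFun x = (j - i) • w.toFun x + i • w.toFun x := by
        rw [← add_nsmul, Nat.sub_add_cancel hij.le]
      rw [w.map_mul, w.map_mul, w.map_pow, w.map_pow, hjx, ← add_assoc] at he
      rw [← neg_add_cancel_left (w.toFun (c j)) ((j - i) • w.toFun x), ← add_right_cancel he]
    rw [hji]
    exact (hadd j hj h).neg_left.add_left (hadd i hi h)
  rcases lt_or_gt_of_ne hij with h | h
  · exact key i hi j hj h he
  · exact key j hj i hi h he.symm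

theorem exists_le_nsmul_of_height_eq_one [FiniteDimensional (Subring.center D) D]
    (hw : w.height = 1) {g : Γ} (hg : 0 < g) (h : Γ) : ∃ n : ℕ, h ≤ n • g :=
  exists_le_nsmul_of_ordHeight_eq_one w.exists_nsmul_central hw hg h

theorem exists_pos_of_height_eq_one (hw : w.height = 1) : ∃ b : Dˣ, 0 < w.toFun b := by
  obtain ⟨g, hg⟩ := exists_pos_of_ordHeight_eq_one hw
  obtain ⟨b, rfl⟩ := w.surjective g
  exact ⟨b, hg⟩

theorem IsNontrivial.exists_lt {w : DivValuation D Γ} (hw : w.IsNontrivial) (δ : Γ) :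
    ∃ b : Dˣ, δ < w.toFun b := by
  obtain ⟨x, hx⟩ := hw
  obtain ⟨d, rfl⟩ := w.surjective δ
  rcases lt_or_gt_of_ne hx with h | h
  · exact ⟨d * x⁻¹, by rw [w.map_mul, w.map_inv]; simpa using h⟩
  · exact ⟨d * x, by rw [w.map_mul]; simpa using h⟩

theorem IsAdicOpen.exists_forall_mem {w : DivValuation D Γ} {N : Subgroup Dˣ}
    (hN : w.IsAdicOpen N) :
    ∃ δ : Γ, 0 ≤ δ ∧ ∀ a c : Dˣ, (c : D) = 1 + a → δ < w.toFun a → c ∈ N := by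
  obtain ⟨U, hU, hUN⟩ := hN
  have h1 : (1 : Dˣ) ∈ (fun a : Dˣ => (a : D)) ⁻¹' U := hUN ▸ N.one_mem
  obtain ⟨δ, hδ, h⟩ := hU _ h1
  refine ⟨δ, hδ, fun a c hc ha => ?_⟩
  have : c ∈ (fun a : Dˣ => (a : D)) ⁻¹' U := by
    simpa [hc] using h a (Or.inr ⟨a, rfl, ha⟩)
  rw [hUN] at this
  exact this

theorem IsAdicOpen.of_le {w : DivValuation D Γ} {N M : Subgroup Dˣ}
    (hN : w.IsAdicOpen N) (h : N ≤ M) :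
    ∃ δ : Γ, 0 ≤ δ ∧ ∀ a c : Dˣ, (c : D) = 1 + a → δ < w.toFun a → c ∈ M := by
  obtain ⟨δ, hδ, h1⟩ := hN.exists_forall_mem
  exact ⟨δ, hδ, fun a c hc ha => h (h1 a c hc ha)⟩

end Basic

/-! ### Comparing valuations -/

section Comparison

variable {D : Type u} [DivisionRing D]
  {Γ : Type*} [AddGroup Γ] [LinearOrder Γ] [AddLeftMono Γ] [AddRightMono Γ]
  {Γ' : Type*} [AddGroup Γ'] [LinearOrder Γ'] [AddLeftMono Γ'] [AddRightMono Γ']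
  {Δ : Type*} [AddGroup Δ] [LinearOrder Δ] [AddLeftMono Δ] [AddRightMono Δ]

/-- A subgroup containing a neighbourhood of `1` for each of two valuations satisfying weak
approximation is the whole group. -/
theorem eq_top_of_weak_approximation (u : DivValuation D Δ) (w : DivValuation D Γ)
    (huw : ∀ (δ : Δ) (ε : Γ), ∃ a : Dˣ, δ < u.toFun a ∧ w.toFun a < ε) (N : Subgroup Dˣ)
    (hu : ∃ δ : Δ, 0 ≤ δ ∧ ∀ a c : Dˣ, (c : D) = 1 + a → δ < u.toFun a → c ∈ N)
    (hw : ∃ δ : Γ, 0 ≤ δ ∧ ∀ a c : Dˣ, (c : D) = 1 + a → δ < w.toFun a → c ∈ N) : N = ⊤ := by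
  obtain ⟨δ, hδ, hu⟩ := hu
  obtain ⟨ε, hε, hw⟩ := hw
  rw [eq_top_iff]
  intro x _
  by_cases hx : (x : D) - 1 = 0
  · rw [show x = 1 from Units.ext (sub_eq_zero.1 hx)]
    exact N.one_mem
  let z : Dˣ := Units.mk0 _ hx
  have hz : (z : D) = x - 1 := rfl
  -- With `p = 1 + a`, the element `y = 1 + p⁻¹az = x - p⁻¹z` is `u`-close to `1` and `w`-close to
  -- `x`. The zeros in the bounds give `u p = 0` and `w p = w a`.
  obtain ⟨a, ha, ha'⟩ := huw (max 0 (δ - u.toFun z))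
    (min 0 (w.toFun z - (ε + w.toFun x)))
  obtain ⟨ha0, haδ⟩ := max_lt_iff.1 ha
  obtain ⟨ha0', haε⟩ := lt_min_iff.1 ha'
  have hp : (1 : D) + a ≠ 0 := by
    intro h
    have : a = -1 := Units.ext (by simpa using (eq_neg_of_add_eq_zero_right h))
    rw [this, u.map_neg_one] at ha0
    exact lt_irrefl _ ha0
  let p : Dˣ := Units.mk0 _ hp
  have hpv : (p : D) = 1 + a := rfl
  have hup : u.toFun p = 0 := by
    rw [u.map_add_eq_of_lt (a := 1) (b := a) (by simp [hpv]) (by rwa [u.map_one]), u.map_one]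
  have hwp : w.toFun p = w.toFun a :=
    w.map_add_eq_of_lt (a := a) (b := 1) (by simp [hpv, add_comm]) (by rwa [w.map_one])
  have huq : δ < u.toFun (p⁻¹ * a * z) := by
    rw [u.map_mul, u.map_mul, u.map_inv, hup, neg_zero, zero_add]
    exact sub_lt_iff_lt_add.1 haδ
  have hy : (1 : D) + (p⁻¹ * a * z : Dˣ) ≠ 0 := by
    intro h
    have h1 : p⁻¹ * a * z = -1 := Units.ext (by
      simpa using (eq_neg_of_add_eq_zero_right h))
    rw [h1, u.map_neg_one] at huq
    exact absurd hδ (not_le.2 huq)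
  let y : Dˣ := Units.mk0 _ hy
  have hyv : (y : D) = 1 + (p⁻¹ * a * z : Dˣ) := rfl
  have hyN : y ∈ N := hu _ y hyv huq
  have hyx : (y : D) = x + (p⁻¹ * -z : Dˣ) := by
    apply (Units.isUnit p).mul_left_cancel
    rw [hyv, mul_add, mul_add]
    simp only [Units.val_mul, mul_assoc, Units.mul_inv_cancel_left, Units.val_neg]
    rw [hz, hpv]
    noncomm_ring
  have hyxN : y * x⁻¹ ∈ N := by
    refine hw (p⁻¹ * -z * x⁻¹) _ ?_ ?_
    · rw [Units.val_mul, hyx, add_mul, Units.mul_inv, ← Units.val_mul]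
    · rw [w.map_mul, w.map_mul, w.map_inv, w.map_inv, w.map_neg, hwp, ← sub_eq_add_neg,
        lt_sub_iff_add_lt, lt_neg_add_iff_add_lt, ← lt_sub_iff_add_lt]
      exact haε
  simpa using N.mul_mem (N.inv_mem hyxN) hyN

/-- If `w a < 0 ≤ u a`, multiplying a `u`-large `b` by powers of `a` keeps it `u`-large and drives
its `w`-value below any bound. -/
theorem nonneg_of_not_weak_approximation (u : DivValuation D Δ) (w : DivValuation D Γ)
    (hu : u.IsNontrivial) (harch : ∀ g : Γ, 0 < g → ∀ h : Γ, ∃ n : ℕ, h ≤ n • g)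
    (huw : ¬ ∀ (δ : Δ) (ε : Γ), ∃ a : Dˣ, δ < u.toFun a ∧ w.toFun a < ε)
    (a : Dˣ) (ha : 0 ≤ u.toFun a) : 0 ≤ w.toFun a := by
  push Not at huw
  obtain ⟨δ, ε, h⟩ := huw
  by_contra! hlt
  obtain ⟨b, hb⟩ := hu.exists_lt δ
  obtain ⟨n, hn⟩ := harch (w.toFun a⁻¹) (by rw [w.map_inv]; simpa using hlt)
    (w.toFun b - ε)
  -- The power `n` only brings the `w`-value down to `ε`; one more factor makes it strictly smaller.
  have h1 := h (a ^ (n + 1) * b) (by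
    rw [u.map_mul, u.map_pow]
    exact hb.trans_le (le_add_of_nonneg_left (nsmul_nonneg ha _)))
  rw [← w.map_pow, inv_pow, w.map_inv, w.map_pow, le_neg, neg_sub] at hn
  rw [w.map_mul, w.map_pow, ← sub_le_iff_le_add, succ_nsmul'] at h1
  exact absurd (h1.trans (add_le_add_right hn _)) (not_le.2 (add_lt_of_neg_left _ hlt))

/-- Taking inverses in `h`, positive `w`-value forces nonnegative `u`-value, hence nonnegative
`w'`-value. If `w' a < 0 ≤ w a`, then `a ^ (n + 1) * b` with `w b > 0` and `n` large violates this.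
-/
theorem nonneg_of_common_refinement (u : DivValuation D Δ) (w : DivValuation D Γ)
    (w' : DivValuation D Γ') (hw : ∃ b : Dˣ, 0 < w.toFun b)
    (harch : ∀ g : Γ', 0 < g → ∀ h : Γ', ∃ n : ℕ, h ≤ n • g)
    (h : ∀ a, 0 ≤ u.toFun a → 0 ≤ w.toFun a) (h' : ∀ a, 0 ≤ u.toFun a → 0 ≤ w'.toFun a)
    (a : Dˣ) (ha : 0 ≤ w.toFun a) : 0 ≤ w'.toFun a := by
  by_contra! hlt
  obtain ⟨b, hb⟩ := hw
  obtain ⟨n, hn⟩ := harch (w'.toFun a⁻¹) (by rw [w'.map_inv]; simpa using hlt) (w'.toFun b)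
  have h1 : 0 < w.toFun (a ^ (n + 1) * b) := by
    rw [w.map_mul, w.map_pow]
    exact add_pos_of_nonneg_of_pos (nsmul_nonneg ha _) hb
  have h2 : 0 ≤ u.toFun (a ^ (n + 1) * b) := by
    by_contra! h3
    have := h (a ^ (n + 1) * b)⁻¹ (by rw [u.map_inv]; simpa using h3.le)
    rw [w.map_inv] at this
    exact absurd h1 (not_lt.2 (by simpa using this))
  have h4 := h' _ h2
  rw [← w'.map_pow, inv_pow, w'.map_inv] at hn
  rw [pow_succ', mul_assoc, w'.map_mul, w'.map_mul] at h4
  refine absurd h4 (not_le.2 (add_neg_of_neg_of_nonpos hlt ?_))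
  simpa using add_le_add_right hn (w'.toFun (a ^ n))

/-- Applied to `a⁻¹ * b`, the hypothesis shows that both valuations order the units alike, so
lifting along one and evaluating the other is well defined. -/
theorem isEquiv_of_nonneg_iff (w : DivValuation D Γ) (w' : DivValuation D Γ')
    (h : ∀ a, 0 ≤ w.toFun a ↔ 0 ≤ w'.toFun a) : w.IsEquiv w' := by
  have hle : ∀ a b, w.toFun a ≤ w.toFun b ↔ w'.toFun a ≤ w'.toFun b := fun a b => by
    have := h (a⁻¹ * b)
    rw [w.map_mul, w'.map_mul, w.map_inv, w'.map_inv] at this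
    simpa using this
  have heq : ∀ a b, w.toFun a = w.toFun b ↔ w'.toFun a = w'.toFun b := fun a b => by
    rw [le_antisymm_iff, le_antisymm_iff, hle, hle]
  let s := Function.surjInv w.surjective
  let s' := Function.surjInv w'.surjective
  have hs : ∀ g, w.toFun (s g) = g := Function.surjInv_eq w.surjective
  have hs' : ∀ g, w'.toFun (s' g) = g := Function.surjInv_eq w'.surjective
  refine ⟨{ toFun := fun g => w'.toFun (s g), invFun := fun g => w.toFun (s' g),
            left_inv := fun g => ?_, right_inv := fun g => ?_, map_add' := fun g g' => ?_,
            map_le_map_iff' := ?_ }, fun x => ?_⟩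
  · exact ((heq _ _).2 (hs' _)).trans (hs g)
  · exact ((heq _ _).1 (hs _)).trans (hs' g)
  · rw [← w'.map_mul, ← heq, w.map_mul, hs, hs, hs]
  · intro g g'
    rw [← hle, hs, hs]
  · exact (heq _ _).1 (hs _).symm

end Comparison

end DivValuation

theorem mainTheorem10 {D : Type*} [DivisionRing D] [FiniteDimensional (Subring.center D) D]
    (r : ℕ) (hr : 2 ≤ r)
    (Γ : Fin r → Type*) [∀ i, AddGroup (Γ i)] [∀ i, LinearOrder (Γ i)]
    [∀ i, AddLeftMono (Γ i)] [∀ i, AddRightMono (Γ i)]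
    (w : ∀ i, DivValuation D (Γ i))
    (hheight : ∀ i, (w i).height = 1)
    (hdistinct : ∀ i j, i ≠ j → ¬ (w i).IsEquiv (w j))
    (N : Fin r → Subgroup Dˣ)
    (hproper : ∀ i, N i ≠ ⊤)
    (hopen : ∀ i, (w i).IsAdicOpen (N i)) :
    ∀ (Γu : Type*) [AddGroup Γu] [LinearOrder Γu] [AddLeftMono Γu] [AddRightMono Γu]
      (u : DivValuation D Γu), u.IsNontrivial → ¬ u.IsAdicOpen (⨅ i, N i) := by
  intro Γu _ _ _ _ u hu hN
  have harch : ∀ i, ∀ g : Γ i, 0 < g → ∀ h : Γ i, ∃ n : ℕ, h ≤ n • g := fun i _ hg h =>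
    (w i).exists_le_nsmul_of_height_eq_one (hheight i) hg h
  have hnn : ∀ i a, 0 ≤ u.toFun a → 0 ≤ (w i).toFun a := fun i =>
    DivValuation.nonneg_of_not_weak_approximation u (w i) hu (harch i) fun h =>
      hproper i (DivValuation.eq_top_of_weak_approximation u (w i) h (N i)
        (hN.of_le (iInf_le N i)) (hopen i).exists_forall_mem)
  have hij : ∀ i j a, 0 ≤ (w i).toFun a → 0 ≤ (w j).toFun a := fun i j =>
    DivValuation.nonneg_of_common_refinement u (w i) (w j)
      ((w i).exists_pos_of_height_eq_one (hheight i)) (harch j) (hnn i) (hnn j)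
  exact hdistinct ⟨0, by omega⟩ ⟨1, by omega⟩ (by simp)
    (DivValuation.isEquiv_of_nonneg_iff _ _ fun a => ⟨hij _ _ a, hij _ _ a⟩)
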